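/- An orthogonal array $\mathrm{OA}(m,n)$ is an $m\times n^2$ array with entries from an $n$-element set such that, for any two of its rows, the $n^2$ ordered pairs formed by these two rows (one pair for each column) are pairwise distinct. An $\mathrm{OA}(n+1,n)$ is called a full orthogonal array. Let $m$ and $n$ be positive integers, with $m\le 2$ in the case $n=1$, and let $\delta=n-m+1$. If $$n>\tfrac{8}{3}\delta^3-\tfrac{16}{3}\delta^2+2\delta+\tfrac{2}{3},$$ then every orthogonal array $\mathrm{OA}(m,n)$ can be extended to a full orthogonal array; that is, $m\le n+1$, and one can append $n+1-m=\delta$ rows with entries from the same $n$-element set so that the result is an $\mathrm{OA}(n+1,n)$. -/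

import Mathlib

/-- An array with `m` rows and `n ^ 2` columns and entries in `S` is an orthogonal array
`OA(m, n)` if `S` has exactly `n` elements and, for any two rows, the `n ^ 2` ordered pairs
formed by these two rows (one pair for each column) are pairwise distinct. -/
def IsOrthogonalArray {S : Type*} [Fintype S] (m n : ℕ)
    (A : Matrix (Fin m) (Fin (n ^ 2)) S) : Prop :=
  Fintype.card S = n ∧
    ∀ i j : Fin m, i ≠ j → Function.Injective fun c : Fin (n ^ 2) => (A i c, A j c)

/-- An orthogonal array `OA(n + 1, n)` is a full orthogonal array. -/
def IsFullOrthogonalArray {S : Type*} [Fintype S] (n : ℕ)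
    (B : Matrix (Fin (n + 1)) (Fin (n ^ 2)) S) : Prop :=
  IsOrthogonalArray (n + 1) n B

/-- The array `A` with `m` rows can be extended to a full orthogonal array: `m ≤ n + 1`, and there
is a full orthogonal array over the same set of entries whose first `m` rows are those of `A`. -/
def ExtendsToFull {S : Type*} [Fintype S] (m n : ℕ)
    (A : Matrix (Fin m) (Fin (n ^ 2)) S) : Prop :=
  ∃ h : m ≤ n + 1, ∃ B : Matrix (Fin (n + 1)) (Fin (n ^ 2)) S,
    IsFullOrthogonalArray n B ∧ ∀ (i : Fin m) (c : Fin (n ^ 2)), B (Fin.castLE h i) c = A i c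

/-!
Let two columns of `A` be adjacent when they disagree in every row. Counting with the orthogonality
of the rows gives this graph the parameters of a net with `δ` parallel classes: it has degree
`δ (n - 1)`, and the numbers of common neighbours are known for adjacent vertices and bounded for
nonadjacent ones. The clique method of Bruck and Metsch recovers the lines of the net. Around a
vertex `x`, take a largest claw (an induced star with centre `x`); since nonadjacent vertices have
few common neighbours, each leaf has many neighbours in the neighbourhood of `x` that are adjacent
to no other leaf, these form a clique, and the maximal cliques obtained in this way cover all edges
at `x`. Large maximal cliques meet in at most one vertex, so they partition the edges, and counting
shows that `δ` of them, with `n` vertices each, pass through every vertex.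

The cliques parallel to a given one partition the columns into `n` classes; labelling the columns by
these classes gives a row orthogonal to all rows of `A`. The bound is inherited by smaller `δ`, so
rows can be added until the array is full.
-/

section Claws

open Finset

theorem sum_card_le_card_biUnion_add_choose_two_mul {ι α : Type*} [DecidableEq α] {q : ℕ}
    (T : Finset ι) {B : ι → Finset α}
    (hB : (T : Set ι).Pairwise fun i j => #(B i ∩ B j) ≤ q) :
    ∑ i ∈ T, #(B i) ≤ #(T.biUnion B) + (#T).choose 2 * q := by
  classical
  induction T using Finset.induction_on with
  | empty => simp
  | insert i T hi ih =>
    rw [coe_insert, Set.pairwise_insert] at hB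
    have hinter : #(B i ∩ T.biUnion B) ≤ #T * q := by
      rw [inter_biUnion]
      exact card_biUnion_le_card_mul _ _ _ fun j hj =>
        (hB.2 j hj (ne_of_mem_of_not_mem hj hi).symm).1
    have hchoose : (#T + 1).choose 2 = #T + (#T).choose 2 := by
      rw [Nat.choose_succ_succ', Nat.choose_one_right]
    have hunion := card_union_add_card_inter (B i) (T.biUnion B)
    rw [sum_insert hi, biUnion_insert, card_insert_of_notMem hi, hchoose, add_mul]
    linarith [ih hB.1]

variable {V : Type*} {G : SimpleGraph V} {x : V} {S T : Finset V} {l p q : ℕ}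

/-- `T` is the set of leaves of an induced star with centre `x`. -/
structure IsClaw (G : SimpleGraph V) (x : V) (T : Finset V) : Prop where
  adj : ∀ y ∈ T, G.Adj x y
  isIndepSet : G.IsIndepSet T

theorem IsClaw.mono (hT : IsClaw G x T) (hST : S ⊆ T) : IsClaw G x S :=
  ⟨fun y hy => hT.adj y (hST hy), hT.isIndepSet.mono (coe_subset.2 hST)⟩

theorem IsClaw.not_adj (hT : IsClaw G x T) {y z : V} (hy : y ∈ T) (hz : z ∈ T) : ¬ G.Adj y z :=
  fun h => hT.isIndepSet hy hz h.ne h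

protected theorem IsClaw.insert [DecidableEq V] (hT : IsClaw G x T) {w : V} (hw : G.Adj x w)
    (hwT : ∀ y ∈ T, ¬ G.Adj w y) : IsClaw G x (insert w T) := by
  refine ⟨by simpa [hw] using hT.adj, ?_⟩
  rw [SimpleGraph.isIndepSet_iff, coe_insert, Set.pairwise_insert]
  exact ⟨hT.isIndepSet, fun y hy _ => ⟨hwT y hy, fun h => hwT y hy h.symm⟩⟩

/-- `S` is a largest claw with centre `x`. -/
structure IsMaximumClaw (G : SimpleGraph V) (x : V) (S : Finset V) : Prop extends
    IsClaw G x S where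
  card_le : ∀ T, IsClaw G x T → #T ≤ #S

theorem exists_isMaximumClaw [Finite V] (G : SimpleGraph V) (x : V) :
    ∃ S, IsMaximumClaw G x S := by
  classical
  have := Fintype.ofFinite V
  have hempty : IsClaw G x ∅ := ⟨by simp, by simp⟩
  obtain ⟨S, hS, hmax⟩ := exists_max_image {T | IsClaw G x T} card
    ⟨∅, mem_filter.2 ⟨mem_univ _, hempty⟩⟩
  exact ⟨S, (mem_filter.1 hS).2, fun T hT => hmax T (mem_filter.2 ⟨mem_univ T, hT⟩)⟩

variable [Fintype V] [DecidableEq V] [DecidableRel G.Adj]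

/-- Any two distinct nonadjacent vertices of `G` have at most `μ` common neighbours, as in a
strongly regular graph with parameter `μ`. Here `μ` is often `q + 1`, since the centre of a claw is
one of the common neighbours of any two leaves. -/
def NonadjCommonNeighborsLE (G : SimpleGraph V) [DecidableRel G.Adj] (μ : ℕ) : Prop :=
  Pairwise fun y z => ¬ G.Adj y z → #(G.neighborFinset y ∩ G.neighborFinset z) ≤ μ

theorem NonadjCommonNeighborsLE.card_le (hμ : NonadjCommonNeighborsLE G (q + 1)) {y z : V}
    (hy : G.Adj x y) (hz : G.Adj x z) (hne : y ≠ z) (hyz : ¬ G.Adj y z) {U : Finset V}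
    (hx : x ∉ U) (hU : ∀ u ∈ U, G.Adj y u ∧ G.Adj z u) : #U ≤ q := by
  have hsub : insert x U ⊆ G.neighborFinset y ∩ G.neighborFinset z := by
    refine insert_subset (by simp [hy.symm, hz.symm]) fun u hu => ?_
    simpa using hU u hu
  have hcard := (card_le_card hsub).trans (hμ hne hyz)
  rw [card_insert_of_notMem hx] at hcard
  omega

theorem NonadjCommonNeighborsLE.card_inter_neighborFinset_le
    (hμ : NonadjCommonNeighborsLE G (q + 1)) {K : Finset V} (hK : G.IsClique K)
    (hKx : K ⊆ G.neighborFinset x) {u z : V} (hu : G.Adj x u) (hz : z ∈ K) (hzu : z ≠ u)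
    (hadj : ¬ G.Adj z u) : #(K ∩ G.neighborFinset u) ≤ q := by
  refine hμ.card_le (by simpa using hKx hz) hu hzu hadj (fun h => ?_) fun v hv => ?_
  · simpa using hKx (mem_inter.1 h).1
  · rw [mem_inter, SimpleGraph.mem_neighborFinset] at hv
    exact ⟨hK hz hv.1 fun h => hadj (h ▸ hv.2.symm), hv.2⟩

/-- Each leaf together with its common neighbours with the centre gives `l + 1` vertices of the
neighbourhood of the centre, and two of these sets share at most `q` vertices. -/
theorem IsClaw.card_mul_le (hT : IsClaw G x T)
    (hl : ∀ y ∈ T, l ≤ #(G.neighborFinset x ∩ G.neighborFinset y))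
    (hμ : NonadjCommonNeighborsLE G (q + 1)) :
    #T * (l + 1) ≤ G.degree x + (#T).choose 2 * q := by
  set B : V → Finset V := fun y => insert y (G.neighborFinset x ∩ G.neighborFinset y) with hB
  have hcard : #T * (l + 1) ≤ ∑ y ∈ T, #(B y) := by
    rw [← smul_eq_mul]
    refine card_nsmul_le_sum _ _ _ fun y hy => ?_
    rw [hB, card_insert_of_notMem (by simp)]
    exact Nat.succ_le_succ (hl y hy)
  have hinter : (T : Set V).Pairwise fun y z => #(B y ∩ B z) ≤ q := by
    intro y hy z hz hyz
    have hadj := hT.not_adj hy hz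
    refine hμ.card_le (hT.adj y hy) (hT.adj z hz) hyz hadj ?_ fun u hu => ?_
    · simp [hB, (hT.adj y hy).ne]
    · simp only [hB, mem_inter, mem_insert, SimpleGraph.mem_neighborFinset] at hu
      obtain ⟨rfl | hyu, rfl | hzu⟩ := hu
      · exact absurd rfl hyz
      · exact absurd hzu.2.symm hadj
      · exact absurd hyu.2 hadj
      · exact ⟨hyu.2, hzu.2⟩
  have hsub : T.biUnion B ⊆ G.neighborFinset x := by
    refine biUnion_subset.2 fun y hy => insert_subset ?_ inter_subset_left
    simpa using hT.adj y hy
  calc #T * (l + 1) ≤ ∑ y ∈ T, #(B y) := hcard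
    _ ≤ #(T.biUnion B) + (#T).choose 2 * q := sum_card_le_card_biUnion_add_choose_two_mul T hinter
    _ ≤ G.degree x + (#T).choose 2 * q := by
      rw [← G.card_neighborFinset_eq_degree]
      gcongr

theorem IsClaw.card_le (hT : IsClaw G x T)
    (hl : ∀ y, G.Adj x y → l ≤ #(G.neighborFinset x ∩ G.neighborFinset y))
    (hμ : NonadjCommonNeighborsLE G (q + 1))
    (hp : G.degree x + (p + 2).choose 2 * q < (p + 2) * (l + 1)) : #T ≤ p + 1 := by
  by_contra! hcard
  obtain ⟨U, hUT, hU⟩ := exists_subset_card_eq (show p + 2 ≤ #T from hcard)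
  have := (hT.mono hUT).card_mul_le (fun y hy => hl y (hT.adj y (hUT hy))) hμ
  rw [hU] at this
  omega

/-- The leaf `y` of the claw `S` with centre `x` together with the common neighbours of `x` and `y`
that are adjacent to no other leaf. -/
def privateNeighbors (G : SimpleGraph V) [DecidableRel G.Adj] (x : V) (S : Finset V) (y : V) :
    Finset V :=
  {z ∈ G.neighborFinset x | (z = y ∨ G.Adj y z) ∧ ∀ y' ∈ S, y' ≠ y → ¬ G.Adj y' z}

theorem mem_privateNeighbors {y z : V} : z ∈ privateNeighbors G x S y ↔
    G.Adj x z ∧ (z = y ∨ G.Adj y z) ∧ ∀ y' ∈ S, y' ≠ y → ¬ G.Adj y' z := by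
  simp [privateNeighbors]

theorem privateNeighbors_subset {y : V} : privateNeighbors G x S y ⊆ G.neighborFinset x :=
  filter_subset _ _

theorem IsClaw.mem_privateNeighbors_self (hS : IsClaw G x S) {y : V} (hy : y ∈ S) :
    y ∈ privateNeighbors G x S y :=
  mem_privateNeighbors.2 ⟨hS.adj y hy, Or.inl rfl, fun _ hy' _ => hS.not_adj hy' hy⟩

theorem IsClaw.eq_of_mem_privateNeighbors (hS : IsClaw G x S) {y y' z : V} (hy : y ∈ S)
    (hy' : y' ∈ S) (hz : z ∈ privateNeighbors G x S y) (hz' : z ∈ privateNeighbors G x S y') :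
    y = y' := by
  rw [mem_privateNeighbors] at hz hz'
  by_contra hne
  obtain rfl := hz.2.1.resolve_right (hz'.2.2 y hy hne)
  exact hS.not_adj hy' hy (hz'.2.1.resolve_left hne)

theorem IsMaximumClaw.isClique_privateNeighbors (hS : IsMaximumClaw G x S) {y : V} (hy : y ∈ S) :
    G.IsClique (privateNeighbors G x S y : Set V) := by
  intro u hu v hv huv
  rw [mem_coe, mem_privateNeighbors] at hu hv
  by_contra hadj
  have hyu : G.Adj y u := hu.2.1.resolve_left fun h =>
    hadj (h ▸ hv.2.1.resolve_left (h ▸ huv.symm))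
  have hyv : G.Adj y v := hv.2.1.resolve_left fun h => hadj (h ▸ hyu.symm)
  have hSy := hS.toIsClaw.mono (erase_subset y S)
  have hclaw : IsClaw G x (insert u (insert v (S.erase y))) := by
    refine (hSy.insert hv.1 fun a ha h => ?_).insert hu.1 fun a ha h => ?_
    · exact hv.2.2 a (mem_of_mem_erase ha) (ne_of_mem_erase ha) h.symm
    · obtain rfl | ha := mem_insert.1 ha
      · exact hadj h
      · exact hu.2.2 a (mem_of_mem_erase ha) (ne_of_mem_erase ha) h.symm
  have huS : u ∉ S := fun h => hS.not_adj hy h hyu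
  have hvS : v ∉ S := fun h => hS.not_adj hy h hyv
  have hcard := hS.card_le _ hclaw
  rw [card_insert_of_notMem (by simp [huv, huS]), card_insert_of_notMem (by simp [hvS])] at hcard
  have := card_erase_add_one hy
  omega

theorem IsClaw.add_one_le_card_privateNeighbors_add (hS : IsClaw G x S) {y : V} (hy : y ∈ S)
    (hl : l ≤ #(G.neighborFinset x ∩ G.neighborFinset y))
    (hμ : NonadjCommonNeighborsLE G (q + 1)) :
    l + 1 ≤ #(privateNeighbors G x S y) + (#S - 1) * q := by
  set W : V → Finset V := fun y' =>
    (G.neighborFinset x ∩ G.neighborFinset y) ∩ G.neighborFinset y' with hW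
  have hsub : insert y (G.neighborFinset x ∩ G.neighborFinset y) ⊆
      privateNeighbors G x S y ∪ (S.erase y).biUnion W := by
    refine insert_subset (mem_union_left _ (hS.mem_privateNeighbors_self hy)) fun z hz => ?_
    have hz' := hz
    rw [mem_inter, SimpleGraph.mem_neighborFinset, SimpleGraph.mem_neighborFinset] at hz'
    by_cases hprivate : ∀ y' ∈ S, y' ≠ y → ¬ G.Adj y' z
    · exact mem_union_left _ (mem_privateNeighbors.2 ⟨hz'.1, Or.inr hz'.2, hprivate⟩)
    · push Not at hprivate
      obtain ⟨y', hy', hne, hadj⟩ := hprivate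
      refine mem_union_right _ (mem_biUnion.2 ⟨y', mem_erase.2 ⟨hne, hy'⟩, ?_⟩)
      exact mem_inter.2 ⟨hz, by simpa using hadj⟩
  have hWcard : #((S.erase y).biUnion W) ≤ (#S - 1) * q := by
    rw [← card_erase_of_mem hy]
    refine card_biUnion_le_card_mul _ _ _ fun y' hy' => ?_
    obtain ⟨hne, hy'⟩ := mem_erase.1 hy'
    refine hμ.card_le (hS.adj y hy) (hS.adj y' hy') hne.symm (hS.not_adj hy hy') (by simp [hW])
      fun u hu => ?_
    simp only [hW, mem_inter, SimpleGraph.mem_neighborFinset] at hu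
    exact ⟨hu.1.2, hu.2⟩
  calc l + 1 ≤ #(insert y (G.neighborFinset x ∩ G.neighborFinset y)) := by
        rw [card_insert_of_notMem (by simp)]
        exact Nat.succ_le_succ hl
    _ ≤ #(privateNeighbors G x S y ∪ (S.erase y).biUnion W) := card_le_card hsub
    _ ≤ #(privateNeighbors G x S y) + (#S - 1) * q :=
        (card_union_le _ _).trans (Nat.add_le_add_left hWcard _)

theorem exists_pairwise_not_adj_transversal [Nonempty V] {ι : Type*} {T : Finset ι}
    {C : ι → Finset V} (hC : ∀ i ∈ T, #T * q < #(C i) + q)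
    (hq : ∀ i ∈ T, ∀ j ∈ T, i ≠ j → ∀ u ∈ C j, #(C i ∩ G.neighborFinset u) ≤ q) :
    ∃ f : ι → V, (∀ i ∈ T, f i ∈ C i) ∧
      (T : Set ι).Pairwise fun i j => ¬ G.Adj (f i) (f j) := by
  classical
  induction T using Finset.induction_on with
  | empty =>
    obtain ⟨v⟩ := ‹Nonempty V›
    exact ⟨fun _ => v, by simp⟩
  | insert i T hi ih =>
    rw [card_insert_of_notMem hi] at hC
    obtain ⟨f, hfC, hf⟩ := ih
      (fun j hj => (Nat.mul_le_mul_right q (Nat.le_succ _)).trans_lt (hC j (mem_insert_of_mem hj)))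
      fun j hj k hk => hq j (mem_insert_of_mem hj) k (mem_insert_of_mem hk)
    have hforbidden : #(T.biUnion fun j => C i ∩ G.neighborFinset (f j)) ≤ #T * q :=
      card_biUnion_le_card_mul _ _ _ fun j hj => hq i (mem_insert_self i T) j
        (mem_insert_of_mem hj) (ne_of_mem_of_not_mem hj hi).symm _ (hfC j hj)
    have hlt : #T * q < #(C i) := by linarith [hC i (mem_insert_self i T)]
    obtain ⟨z, hz, hzf⟩ := exists_mem_notMem_of_card_lt_card (hforbidden.trans_lt hlt)
    replace hzf : ∀ j ∈ T, ¬ G.Adj (f j) z := fun j hj hadj =>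
      hzf (mem_biUnion.2 ⟨j, hj, mem_inter.2 ⟨hz, by simpa using hadj⟩⟩)
    have hupdate : ∀ j ∈ T, Function.update f i z j = f j := fun j hj =>
      Function.update_of_ne (ne_of_mem_of_not_mem hj hi) _ _
    refine ⟨Function.update f i z, ?_, ?_⟩
    · rw [forall_mem_insert, Function.update_self]
      exact ⟨hz, fun j hj => (hupdate j hj).symm ▸ hfC j hj⟩
    · rw [coe_insert, Set.pairwise_insert, Function.update_self]
      refine ⟨fun j hj k hk hjk => ?_, fun j hj _ => ?_⟩
      · simpa only [hupdate j hj, hupdate k hk] using hf hj hk hjk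
      · rw [hupdate j hj]
        exact ⟨fun h => hzf j hj h.symm, hzf j hj⟩

theorem IsClaw.card_privateNeighbors_inter_neighborFinset_le (hS : IsClaw G x S) {y y' u : V}
    (hy : y ∈ S) (hy' : y' ∈ S) (hne : y ≠ y') (hu : u ∈ privateNeighbors G x S y')
    (hclique : G.IsClique (privateNeighbors G x S y : Set V))
    (hμ : NonadjCommonNeighborsLE G (q + 1)) :
    #(privateNeighbors G x S y ∩ G.neighborFinset u) ≤ q := by
  have hyC := hS.mem_privateNeighbors_self hy
  refine hμ.card_inter_neighborFinset_le hclique privateNeighbors_subset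
    (mem_privateNeighbors.1 hu).1 hyC ?_ ((mem_privateNeighbors.1 hu).2.2 y hy hne)
  rintro rfl
  exact hne (hS.eq_of_mem_privateNeighbors hy hy' hyC hu)

theorem IsMaximumClaw.exists_adj_of_transversal (hS : IsMaximumClaw G x S) {f : V → V}
    (hfC : ∀ y ∈ S, f y ∈ privateNeighbors G x S y)
    (hf : (S : Set V).Pairwise fun y y' => ¬ G.Adj (f y) (f y')) {w : V} (hw : G.Adj x w)
    (hfw : ∀ y ∈ S, f y ≠ w) : ∃ y ∈ S, G.Adj w (f y) := by
  by_contra! hcon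
  have hinj : Set.InjOn f S := fun y hy y' hy' h =>
    hS.eq_of_mem_privateNeighbors hy hy' (hfC y hy) (h ▸ hfC y' hy')
  have hclaw : IsClaw G x (insert w (S.image f)) := by
    refine IsClaw.insert ⟨?_, ?_⟩ hw (forall_mem_image.2 hcon)
    · exact forall_mem_image.2 fun y hy => (mem_privateNeighbors.1 (hfC y hy)).1
    · rw [coe_image]
      exact Set.Pairwise.image hf
  have hle := hS.card_le _ hclaw
  rw [card_insert_of_notMem (by simpa using hfw), card_image_of_injOn hinj] at hle
  omega

/-- If every private neighbourhood had a vertex not adjacent to `w`, pairwise nonadjacent private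
neighbours that are not adjacent to `w` could be chosen greedily, one per leaf, and together with
`w` they would form a larger claw. -/
theorem IsMaximumClaw.exists_forall_privateNeighbors_adj (hS : IsMaximumClaw G x S)
    (hμ : NonadjCommonNeighborsLE G (q + 1))
    (hcard : ∀ y ∈ S, #S * q < #(privateNeighbors G x S y)) {w : V} (hw : G.Adj x w) :
    ∃ y ∈ S, ∀ z ∈ privateNeighbors G x S y, z ≠ w → G.Adj z w := by
  by_contra! hcon
  set C := privateNeighbors G x S
  have hclique : ∀ y ∈ S, G.IsClique (C y : Set V) := fun y hy => hS.isClique_privateNeighbors hy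
  have hwC : ∀ y ∈ S, w ∉ C y := by
    intro y hy hwy
    obtain ⟨z, hz, hzw, hadj⟩ := hcon y hy
    exact hadj (hclique y hy hz hwy hzw)
  have hlarge : ∀ y ∈ S, #S * q < #(C y \ G.neighborFinset w) + q := by
    intro y hy
    obtain ⟨z, hz, hzw, hadj⟩ := hcon y hy
    have hinter := hμ.card_inter_neighborFinset_le (hclique y hy) privateNeighbors_subset hw hz
      hzw hadj
    have := card_sdiff_add_card_inter (C y) (G.neighborFinset w)
    linarith [hcard y hy]
  have : Nonempty V := ⟨x⟩
  obtain ⟨f, hfC, hf⟩ := exists_pairwise_not_adj_transversal hlarge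
    fun y hy y' hy' hne u hu => (card_le_card (inter_subset_inter_right sdiff_subset)).trans
      (hS.card_privateNeighbors_inter_neighborFinset_le hy hy' hne (mem_sdiff.1 hu).1
        (hclique y hy) hμ)
  simp only [mem_sdiff, SimpleGraph.mem_neighborFinset] at hfC
  obtain ⟨y, hy, hadj⟩ := hS.exists_adj_of_transversal (fun y hy => (hfC y hy).1) hf hw
    fun y hy h => hwC y hy (h ▸ (hfC y hy).1)
  exact (hfC y hy).2 hadj

end Claws

section CliquePartitions

open Finset

variable {V : Type*} {G : SimpleGraph V} {b : ℕ} {M N : Finset V}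

/-- A maximal clique of `G` with at least `b` vertices (a grand clique in the terminology of
Bruck). -/
structure IsGrandClique (G : SimpleGraph V) (b : ℕ) (M : Finset V) : Prop where
  maximal : Maximal (fun K : Finset V => G.IsClique K) M
  le_card : b ≤ #M

/-- A family of cliques with at least two vertices each, such that every edge of `G` lies in exactly
one of them. -/
structure IsEdgeCliquePartition (G : SimpleGraph V) (L : Finset (Finset V)) : Prop where
  isClique : ∀ M ∈ L, G.IsClique M
  nontrivial : ∀ M ∈ L, M.Nontrivial
  exists_mem : ∀ ⦃x y⦄, G.Adj x y → ∃ M ∈ L, x ∈ M ∧ y ∈ M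
  eq_of_mem : ∀ ⦃M⦄, M ∈ L → ∀ ⦃N⦄, N ∈ L → ∀ ⦃x y⦄, x ≠ y → x ∈ M → y ∈ M → x ∈ N → y ∈ N → M = N

variable [Fintype V] [DecidableEq V] [DecidableRel G.Adj] {l n p q k : ℕ}

theorem NonadjCommonNeighborsLE.mem_of_maximal_isClique (hμ : NonadjCommonNeighborsLE G (q + 1))
    (hM : Maximal (fun K : Finset V => G.IsClique K) M) {K : Finset V} (hKM : K ⊆ M)
    (hK : q + 1 < #K) {w : V} (hw : ∀ z ∈ K, z ≠ w → G.Adj z w) : w ∈ M := by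
  by_contra hwM
  suffices hclique : G.IsClique (insert w M : Finset V) from
    hwM (hM.le_of_ge hclique (subset_insert w M) (mem_insert_self w M))
  rw [coe_insert]
  refine hM.prop.insert fun v hv hwv => ?_
  by_contra hadj
  refine (hK.trans_le ((card_le_card fun z hz => ?_).trans (hμ hwv hadj))).false
  have hzw : G.Adj z w := hw z hz fun h => hwM (h ▸ hKM hz)
  have hzv : G.Adj z v := hM.prop (hKM hz) hv fun h => hadj (h ▸ hzw.symm)
  simpa using ⟨hzw.symm, hzv.symm⟩

theorem card_union_le_card_inter_neighborFinset_add_two (hM : G.IsClique (M : Set V))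
    (hN : G.IsClique (N : Set V)) {x y : V} (hxM : x ∈ M) (hyM : y ∈ M) (hxN : x ∈ N)
    (hyN : y ∈ N) : #(M ∪ N) ≤ #(G.neighborFinset x ∩ G.neighborFinset y) + 2 := by
  have hsub : M ∪ N ⊆ G.neighborFinset x ∩ G.neighborFinset y ∪ {x, y} := by
    intro z hz
    by_contra! hcon
    simp only [mem_union, mem_inter, SimpleGraph.mem_neighborFinset, mem_insert, mem_singleton,
      not_or] at hcon
    obtain hz | hz := mem_union.1 hz
    · exact hcon.1 ⟨hM hxM hz (Ne.symm hcon.2.1), hM hyM hz (Ne.symm hcon.2.2)⟩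
    · exact hcon.1 ⟨hN hxN hz (Ne.symm hcon.2.1), hN hyN hz (Ne.symm hcon.2.2)⟩
  exact (card_le_card hsub).trans ((card_union_le _ _).trans (Nat.add_le_add_left card_le_two _))

theorem IsGrandClique.eq_of_mem (hμ : NonadjCommonNeighborsLE G (q + 1))
    (hl : ∀ x y, G.Adj x y → #(G.neighborFinset x ∩ G.neighborFinset y) ≤ l)
    (hb : l + q + 3 < 2 * b) (hM : IsGrandClique G b M) (hN : IsGrandClique G b N) {x y : V}
    (hxy : x ≠ y) (hxM : x ∈ M) (hyM : y ∈ M) (hxN : x ∈ N) (hyN : y ∈ N) : M = N := by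
  have hinter : q + 1 < #(M ∩ N) := by
    have hadj : G.Adj x y := hM.maximal.prop hxM hyM hxy
    have hunion := (card_union_le_card_inter_neighborFinset_add_two hM.maximal.prop hN.maximal.prop
      hxM hyM hxN hyN).trans (Nat.add_le_add_right (hl x y hadj) 2)
    have := card_union_add_card_inter M N
    have := hM.le_card
    have := hN.le_card
    omega
  refine Subset.antisymm (fun w hw => ?_) fun w hw => ?_
  · exact hμ.mem_of_maximal_isClique hN.maximal inter_subset_right hinter fun z hz hzw =>
      hM.maximal.prop (mem_inter.1 hz).1 hw hzw
  · exact hμ.mem_of_maximal_isClique hM.maximal inter_subset_left hinter fun z hz hzw =>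
      hN.maximal.prop (mem_inter.1 hz).2 hw hzw

theorem IsMaximumClaw.exists_isGrandClique {x : V} {S : Finset V} (hS : IsMaximumClaw G x S)
    (hμ : NonadjCommonNeighborsLE G (q + 1)) {y : V} (hy : y ∈ S)
    (hq : q < #(privateNeighbors G x S y)) (hb : b ≤ #(privateNeighbors G x S y) + 1) :
    ∃ M, IsGrandClique G b M ∧ x ∈ M ∧
      ∀ w, G.Adj x w → (∀ z ∈ privateNeighbors G x S y, z ≠ w → G.Adj z w) → w ∈ M := by
  set K := insert x (privateNeighbors G x S y) with hKdef
  have hx : x ∉ privateNeighbors G x S y := fun h => G.irrefl (mem_privateNeighbors.1 h).1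
  have hcard : #K = #(privateNeighbors G x S y) + 1 := card_insert_of_notMem hx
  have hK : G.IsClique (K : Set V) := by
    rw [hKdef, coe_insert]
    exact (hS.isClique_privateNeighbors hy).insert fun z hz _ =>
      (mem_privateNeighbors.1 (mem_coe.1 hz)).1
  obtain ⟨M, hKM, hM⟩ := Finite.exists_le_maximal (p := fun K : Finset V => G.IsClique K) hK
  refine ⟨M, ⟨hM, (hb.trans hcard.ge).trans (card_le_card hKM)⟩, hKM (mem_insert_self _ _),
    fun w hw hadj => ?_⟩
  refine hμ.mem_of_maximal_isClique hM hKM (by omega) fun z hz hzw => ?_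
  obtain rfl | hz := mem_insert.1 hz
  · exact hw
  · exact hadj z hz hzw

theorem exists_isGrandClique_cover (hμ : NonadjCommonNeighborsLE G (q + 1)) {x : V}
    (hl : ∀ y, G.Adj x y → l ≤ #(G.neighborFinset x ∩ G.neighborFinset y))
    (hclaw : ∀ T, IsClaw G x T → #T ≤ p + 1) (hlq : (2 * p + 1) * q < l + 1) :
    ∃ F : Finset (Finset V), #F ≤ p + 1 ∧ (∀ M ∈ F, IsGrandClique G (l + 2 - p * q) M ∧ x ∈ M) ∧
      ∀ w, G.Adj x w → ∃ M ∈ F, w ∈ M := by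
  obtain ⟨S, hS⟩ := exists_isMaximumClaw G x
  have hSp := hclaw S hS.toIsClaw
  have hprivate : ∀ y ∈ S, l + 1 ≤ #(privateNeighbors G x S y) + p * q := fun y hy =>
    (hS.add_one_le_card_privateNeighbors_add hy (hl y (hS.adj y hy)) hμ).trans (by gcongr; omega)
  have hSq : #S * q ≤ (p + 1) * q := by gcongr
  have hbig : ∀ y ∈ S, #S * q < #(privateNeighbors G x S y) := fun y hy => by
    linarith [hprivate y hy]
  have hgrand : ∀ y ∈ S, ∃ M, IsGrandClique G (l + 2 - p * q) M ∧ x ∈ M ∧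
      ∀ w, G.Adj x w → (∀ z ∈ privateNeighbors G x S y, z ≠ w → G.Adj z w) → w ∈ M := by
    intro y hy
    have hqS : q ≤ #S * q := Nat.le_mul_of_pos_left q (card_pos.2 ⟨y, hy⟩)
    have := hprivate y hy
    exact hS.exists_isGrandClique hμ hy (hqS.trans_lt (hbig y hy)) (by omega)
  choose! M hM hxM hcover using hgrand
  refine ⟨S.image M, card_image_le.trans hSp, ?_, fun w hw => ?_⟩
  · exact forall_mem_image.2 fun y hy => ⟨hM y hy, hxM y hy⟩
  · obtain ⟨y, hy, hadj⟩ := hS.exists_forall_privateNeighbors_adj hμ hbig hw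
    exact ⟨M y, mem_image_of_mem M hy, hcover y hy w hw hadj⟩

theorem exists_isEdgeCliquePartition (hμ : NonadjCommonNeighborsLE G (q + 1))
    (hl : ∀ x y, G.Adj x y → #(G.neighborFinset x ∩ G.neighborFinset y) = l)
    (hclaw : ∀ x T, IsClaw G x T → #T ≤ p + 1) (hlq : (2 * p + 1) * q < l + 1) :
    ∃ L, IsEdgeCliquePartition G L ∧ ∀ x, #{M ∈ L | x ∈ M} ≤ p + 1 := by
  classical
  set b := l + 2 - p * q
  have hpq : 2 * (p * q) + q ≤ l := by linarith
  have heq : ∀ M, IsGrandClique G b M → ∀ N, IsGrandClique G b N → ∀ x y, x ≠ y →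
      x ∈ M → y ∈ M → x ∈ N → y ∈ N → M = N := fun M hM N hN x y =>
    hM.eq_of_mem hμ (fun x y h => (hl x y h).le) (by omega) hN
  have hnontrivial : ∀ M, IsGrandClique G b M → M.Nontrivial := fun M hM =>
    one_lt_card_iff_nontrivial.1 (by have := hM.le_card; omega)
  have hcover := fun x => exists_isGrandClique_cover hμ (fun y h => (hl x y h).ge) (hclaw x) hlq
  refine ⟨({M | IsGrandClique G b M} : Finset (Finset V)), ⟨?_, ?_, ?_, ?_⟩, fun x => ?_⟩
  · exact fun M hM => (mem_filter.1 hM).2.maximal.prop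
  · exact fun M hM => hnontrivial M (mem_filter.1 hM).2
  · intro x y hxy
    obtain ⟨F, -, hF, hFx⟩ := hcover x
    obtain ⟨M, hM, hyM⟩ := hFx y hxy
    exact ⟨M, mem_filter.2 ⟨mem_univ M, (hF M hM).1⟩, (hF M hM).2, hyM⟩
  · exact fun M hM N hN x y => heq M (mem_filter.1 hM).2 N (mem_filter.1 hN).2 x y
  · obtain ⟨F, hFcard, hF, hFx⟩ := hcover x
    refine (card_le_card fun M hM => ?_).trans hFcard
    rw [mem_filter, mem_filter_univ] at hM
    obtain ⟨y, hy, hyx⟩ := (hnontrivial M hM.1).exists_ne x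
    obtain ⟨N, hN, hyN⟩ := hFx y (hM.1.maximal.prop hM.2 hy hyx.symm)
    rwa [heq M hM.1 N (hF N hN).1 x y hyx.symm hM.2 hy (hF N hN).2 hyN]

section

variable {L : Finset (Finset V)}

theorem IsEdgeCliquePartition.sum_card_sub_one (hL : IsEdgeCliquePartition G L) (x : V) :
    ∑ M ∈ L with x ∈ M, (#M - 1) = G.degree x := by
  have hN : G.neighborFinset x = {M ∈ L | x ∈ M}.biUnion fun M => M.erase x := by
    ext w
    simp only [SimpleGraph.mem_neighborFinset, mem_biUnion, mem_filter, mem_erase]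
    constructor
    · intro h
      obtain ⟨M, hM, hx, hw⟩ := hL.exists_mem h
      exact ⟨M, ⟨hM, hx⟩, h.ne', hw⟩
    · rintro ⟨M, ⟨hM, hx⟩, hwx, hw⟩
      exact hL.isClique M hM hx hw hwx.symm
  have hdisj : (({M ∈ L | x ∈ M} : Finset (Finset V)) : Set (Finset V)).PairwiseDisjoint
      fun M => M.erase x := by
    refine fun M hM N hN hMN => disjoint_left.2 fun w hwM hwN => hMN ?_
    rw [mem_coe, mem_filter] at hM hN
    rw [mem_erase] at hwM hwN
    exact hL.eq_of_mem hM.1 hN.1 hwM.1.symm hM.2 hwM.2 hN.2 hwN.2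
  rw [← G.card_neighborFinset_eq_degree, hN, card_biUnion hdisj]
  exact sum_congr rfl fun M hM => (card_erase_of_mem (mem_filter.1 hM).2).symm

/-- A common neighbour of `y` and `y'` outside their common clique `M` is determined by the cliques
that join it to `y` and to `y'`. -/
theorem IsEdgeCliquePartition.card_common_sdiff_le (hL : IsEdgeCliquePartition G L)
    (hp : ∀ x, #{M ∈ L | x ∈ M} ≤ p + 1) (hM : M ∈ L) {y y' : V} (hy : y ∈ M) (hy' : y' ∈ M)
    (hne : y ≠ y') : #((G.neighborFinset y ∩ G.neighborFinset y') \ M) ≤ p ^ 2 := by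
  set Z := (G.neighborFinset y ∩ G.neighborFinset y') \ M
  have hZ : ∀ z ∈ Z, G.Adj y z ∧ G.Adj y' z ∧ z ∉ M := fun z hz => by
    simpa [Z, and_assoc] using hz
  choose! line hline hmem_left hmem_right using fun x y => hL.exists_mem (x := x) (y := y)
  have hmaps : ∀ z ∈ Z, (line y z, line y' z) ∈
      {N ∈ L | y ∈ N}.erase M ×ˢ {N ∈ L | y' ∈ N}.erase M := by
    intro z hz
    obtain ⟨hyz, hy'z, hzM⟩ := hZ z hz
    simp only [mem_product, mem_erase, mem_filter]
    exact ⟨⟨fun h => hzM (h ▸ hmem_right _ _ hyz), hline _ _ hyz, hmem_left _ _ hyz⟩,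
      fun h => hzM (h ▸ hmem_right _ _ hy'z), hline _ _ hy'z, hmem_left _ _ hy'z⟩
  have hinj : Set.InjOn (fun z => (line y z, line y' z)) (Z : Set V) := by
    intro z hz w hw hzw
    obtain ⟨hyz, hy'z, hzM⟩ := hZ z hz
    obtain ⟨hyw, hy'w, -⟩ := hZ w hw
    obtain ⟨heq, heq'⟩ := Prod.mk.inj hzw
    by_contra hzw
    have hlines : line y z = line y' z := hL.eq_of_mem (hline _ _ hyz) (hline _ _ hy'z) hzw
      (hmem_right _ _ hyz) (heq ▸ hmem_right _ _ hyw) (hmem_right _ _ hy'z)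
      (heq' ▸ hmem_right _ _ hy'w)
    have hline_eq : line y z = M := hL.eq_of_mem (hline _ _ hyz) hM hne (hmem_left _ _ hyz)
      (hlines ▸ hmem_left _ _ hy'z) hy hy'
    exact hzM (hline_eq ▸ hmem_right _ _ hyz)
  have herase : ∀ x ∈ M, #({N ∈ L | x ∈ N}.erase M) ≤ p := fun x hx => by
    rw [card_erase_of_mem (mem_filter.2 ⟨hM, hx⟩)]
    exact Nat.sub_le_of_le_add (hp x)
  refine (card_le_card_of_injOn _ hmaps hinj).trans ?_
  rw [card_product, pow_two]
  exact Nat.mul_le_mul (herase y hy) (herase y' hy')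

theorem IsEdgeCliquePartition.add_two_le_card_add_sq (hL : IsEdgeCliquePartition G L)
    (hp : ∀ x, #{M ∈ L | x ∈ M} ≤ p + 1)
    (hl : ∀ x y, G.Adj x y → l ≤ #(G.neighborFinset x ∩ G.neighborFinset y)) (hM : M ∈ L) :
    l + 2 ≤ #M + p ^ 2 := by
  obtain ⟨y, hy, y', hy', hne⟩ := hL.nontrivial M hM
  have hcommon := hl y y' (hL.isClique M hM hy hy' hne)
  have hinter : (G.neighborFinset y ∩ G.neighborFinset y') ∩ M ⊆ (M.erase y).erase y' := by
    intro z hz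
    simp only [mem_inter, SimpleGraph.mem_neighborFinset] at hz
    exact mem_erase.2 ⟨hz.1.2.ne', mem_erase.2 ⟨hz.1.1.ne', hz.2⟩⟩
  have := card_le_card hinter
  have := hL.card_common_sdiff_le hp hM hy hy' hne
  have := card_sdiff_add_card_inter (G.neighborFinset y ∩ G.neighborFinset y') M
  have := card_erase_add_one hy
  have := card_erase_add_one (mem_erase.2 ⟨hne.symm, hy'⟩)
  omega

theorem IsEdgeCliquePartition.card_eq (hL : IsEdgeCliquePartition G L) (hn : 2 ≤ n)
    (hdeg : ∀ x, G.degree x = k * (n - 1)) (hcard : ∀ M ∈ L, #M ≤ n)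
    (hk : ∀ x, #{M ∈ L | x ∈ M} ≤ k) :
    (∀ M ∈ L, #M = n) ∧ ∀ x, #{M ∈ L | x ∈ M} = k := by
  have hle : ∀ M ∈ L, #M - 1 ≤ n - 1 := fun M hM => Nat.sub_le_sub_right (hcard M hM) 1
  have hthrough : ∀ x, #{M ∈ L | x ∈ M} = k := fun x => by
    refine (hk x).antisymm (Nat.le_of_mul_le_mul_right ?_ (show 0 < n - 1 by omega))
    rw [← hdeg, ← hL.sum_card_sub_one]
    exact sum_le_card_nsmul _ _ _ fun M hM => hle M (mem_filter.1 hM).1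
  refine ⟨fun M hM => ?_, hthrough⟩
  obtain ⟨x, hx⟩ := (hL.nontrivial M hM).nonempty
  have hsum : ∑ N ∈ L with x ∈ N, (#N - 1) = ∑ N ∈ L with x ∈ N, (n - 1) := by
    rw [hL.sum_card_sub_one, hdeg, sum_const, hthrough, smul_eq_mul]
  have heq := (sum_eq_sum_iff_of_le fun N hN => hle N (mem_filter.1 hN).1).1 hsum M
    (mem_filter.2 ⟨hM, hx⟩)
  have := one_lt_card_iff_nontrivial.2 (hL.nontrivial M hM)
  omega

theorem IsEdgeCliquePartition.card_filter_mem_le (hL : IsEdgeCliquePartition G L)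
    (hM : ∀ M ∈ L, l + 2 ≤ #M + p ^ 2) {x : V}
    (hdeg : G.degree x + (k + 1) * p ^ 2 < (k + 1) * (l + 1)) : #{M ∈ L | x ∈ M} ≤ k := by
  by_contra! hcard
  have hsum : #{M ∈ L | x ∈ M} * (l + 1) ≤ G.degree x + #{M ∈ L | x ∈ M} * p ^ 2 := by
    rw [← hL.sum_card_sub_one, ← smul_eq_mul, ← smul_eq_mul, ← sum_const, ← sum_const,
      ← sum_add_distrib]
    refine sum_le_sum fun M hMx => ?_
    have := hM M (mem_filter.1 hMx).1
    have := one_lt_card_iff_nontrivial.2 (hL.nontrivial M (mem_filter.1 hMx).1)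
    omega
  nlinarith

/-- The members of `L` that are equal to `C` or disjoint from it; in a net these are the lines
parallel to the line `C`. -/
def parallelClass (L : Finset (Finset V)) (C : Finset V) : Finset (Finset V) :=
  {M ∈ L | M = C ∨ Disjoint M C}

theorem IsEdgeCliquePartition.card_filter_not_disjoint (hL : IsEdgeCliquePartition G L)
    {C : Finset V} (hC : C ∈ L) {x : V} (hx : x ∉ C) :
    #{M ∈ L | x ∈ M ∧ ¬ Disjoint M C} = #(C ∩ G.neighborFinset x) := by
  choose! line hline hmem_left hmem_right using fun x y => hL.exists_mem (x := x) (y := y)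
  symm
  refine card_bij (fun w _ => line x w) (fun w hw => ?_) (fun w hw w' hw' h => ?_) fun M hM => ?_
  · rw [mem_inter, SimpleGraph.mem_neighborFinset] at hw
    exact mem_filter.2 ⟨hline x w hw.2, hmem_left x w hw.2,
      not_disjoint_iff.2 ⟨w, hmem_right x w hw.2, hw.1⟩⟩
  · rw [mem_inter, SimpleGraph.mem_neighborFinset] at hw hw'
    by_contra hne
    have hCline : C = line x w := hL.eq_of_mem hC (hline x w hw.2) hne hw.1 hw'.1
      (hmem_right x w hw.2) (h ▸ hmem_right x w' hw'.2)
    exact hx (hCline ▸ hmem_left x w hw.2)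
  · obtain ⟨hML, hxM, hMC⟩ := mem_filter.1 hM
    obtain ⟨w, hwM, hwC⟩ := not_disjoint_iff.1 hMC
    have hxw : x ≠ w := fun h => hx (h ▸ hwC)
    have hadj : G.Adj x w := hL.isClique M hML hxM hwM hxw
    exact ⟨w, by simpa using ⟨hwC, hadj⟩, hL.eq_of_mem (hline x w hadj) hML hxw
      (hmem_left x w hadj) (hmem_right x w hadj) hxM hwM⟩

theorem IsEdgeCliquePartition.card_parallelClass_filter_mem (hL : IsEdgeCliquePartition G L)
    {C : Finset V} (hC : C ∈ L)
    (hmeet : ∀ x ∉ C, #{M ∈ L | x ∈ M} = #(C ∩ G.neighborFinset x) + 1) (x : V) :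
    #{M ∈ parallelClass L C | x ∈ M} = 1 := by
  by_cases hx : x ∈ C
  · rw [card_eq_one]
    refine ⟨C, ext fun M => ?_⟩
    simp only [parallelClass, mem_filter, mem_singleton]
    constructor
    · rintro ⟨⟨-, hMC⟩, hxM⟩
      exact hMC.resolve_right fun h => disjoint_left.1 h hxM hx
    · rintro rfl
      exact ⟨⟨hC, Or.inl rfl⟩, hx⟩
  · have hparallel : {M ∈ parallelClass L C | x ∈ M} = {M ∈ L | x ∈ M ∧ Disjoint M C} := by
      ext M
      simp only [parallelClass, mem_filter]
      constructor
      · rintro ⟨⟨hM, hMC⟩, hxM⟩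
        exact ⟨hM, hxM, hMC.resolve_left fun h => hx (h ▸ hxM)⟩
      · rintro ⟨hM, hxM, hMC⟩
        exact ⟨⟨hM, Or.inr hMC⟩, hxM⟩
    have hsplit := card_filter_add_card_filter_not (s := {M ∈ L | x ∈ M}) fun M => Disjoint M C
    rw [filter_filter, filter_filter, hL.card_filter_not_disjoint hC hx, hmeet x hx,
      ← hparallel] at hsplit
    omega

end

theorem exists_isEdgeCliquePartition_card_eq (hn : 2 ≤ n)
    (hdeg : ∀ x, G.degree x = k * (n - 1))
    (hl : ∀ x y, G.Adj x y → #(G.neighborFinset x ∩ G.neighborFinset y) = l)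
    (hμ : NonadjCommonNeighborsLE G (q + 1)) (hclique : ∀ M : Finset V, G.IsClique M → #M ≤ n)
    (hlq : (2 * p + 1) * q < l + 1)
    (hclaw : k * (n - 1) + (p + 2).choose 2 * q < (p + 2) * (l + 1))
    (hlines : k * (n - 1) + (k + 1) * p ^ 2 < (k + 1) * (l + 1)) :
    ∃ L, IsEdgeCliquePartition G L ∧ (∀ M ∈ L, #M = n) ∧ ∀ x, #{M ∈ L | x ∈ M} = k := by
  obtain ⟨L, hL, hp⟩ := exists_isEdgeCliquePartition hμ hl (fun x T hT => hT.card_le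
    (fun y h => (hl x y h).ge) hμ (by rwa [hdeg])) hlq
  refine ⟨L, hL, hL.card_eq hn hdeg (fun M hM => hclique M (hL.isClique M hM)) fun x => ?_⟩
  exact hL.card_filter_mem_le (fun M hM => hL.add_two_le_card_add_sq hp
    (fun x y h => (hl x y h).ge) hM) (by rwa [hdeg])

end CliquePartitions

section NetParameters

variable {d l m n p q : ℕ}

theorem two_mul_add_one_mul_lt (hmd : m + d = n) (hl : l + 2 = m + d ^ 2)
    (hq : q + 1 = (d + 1) * d) (hn : 8 * d ^ 3 + 8 * d ^ 2 < 3 * n + 2 * d) (hp : 3 * p ≤ 4 * d) :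
    (2 * p + 1) * q < l + 1 := by
  have := Nat.mul_le_mul_right q hp
  nlinarith

theorem mul_sub_one_add_choose_two_mul_lt (hmd : m + d = n) (hl : l + 2 = m + d ^ 2)
    (hq : q + 1 = (d + 1) * d) (hn : 8 * d ^ 3 + 8 * d ^ 2 < 3 * n + 2 * d) (hp : 3 * p ≤ 4 * d)
    (hdp : 4 * d ≤ 3 * p + 2) :
    (d + 1) * (n - 1) + (p + 2).choose 2 * q < (p + 2) * (l + 1) := by
  have hd : 0 < d := Nat.pos_of_ne_zero (by rintro rfl; simp at hq)
  obtain ⟨N, rfl⟩ : ∃ N, n = N + 1 := ⟨n - 1, by omega⟩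
  have hchoose : (p + 2) * (p + 1) = (p + 2).choose 2 * 2 := by
    simpa using Nat.add_one_mul_choose_eq (p + 1) 1
  rw [Nat.add_sub_cancel]
  suffices 2 * ((d + 1) * N) + (p + 2) * (p + 1) * q < 2 * ((p + 2) * (l + 1)) by
    rw [hchoose] at this
    linarith
  zify at *
  have hq_eq : (q : ℤ) = d ^ 2 + d - 1 := by linarith
  have hl_eq : (l : ℤ) = N + d ^ 2 - d - 1 := by linarith
  have hp_sq : 0 ≤ (q : ℤ) * ((4 * d - 3 * p) * (3 * p + 2 - 4 * d)) :=
    mul_nonneg (by positivity) (mul_nonneg (sub_nonneg.2 hp) (sub_nonneg.2 hdp))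
  have hN := mul_nonneg (show (0 : ℤ) ≤ p - d + 1 by linarith) (sub_nonneg.2 hn.le)
  rw [hq_eq] at hp_sq ⊢
  rw [hl_eq]
  nlinarith

theorem mul_sub_one_add_mul_sq_lt (hmd : m + d = n) (hl : l + 2 = m + d ^ 2)
    (hn : 8 * d ^ 3 + 8 * d ^ 2 < 3 * n + 2 * d) (hp : 3 * p ≤ 4 * d) :
    (d + 1) * (n - 1) + (d + 2) * p ^ 2 < (d + 2) * (l + 1) := by
  obtain ⟨N, rfl⟩ : ∃ N, n = N + 1 := ⟨n - 1, by omega⟩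
  rw [Nat.add_sub_cancel]
  have hsq := Nat.mul_le_mul_left (d + 2) (Nat.pow_le_pow_left hp 2)
  obtain rfl | rfl | hd : d = 0 ∨ d = 1 ∨ 2 ≤ d := by omega
  · obtain rfl : p = 0 := by omega
    nlinarith
  · have : p ≤ 1 := by omega
    nlinarith
  · nlinarith

/-- The parameters are those of `exists_isEdgeCliquePartition_card_eq` for the columns of an
orthogonal array: `l` and `(d + 1) * d` bound the common neighbours of adjacent and of nonadjacent
vertices, and a claw turns out to have at most `4 * d / 3 + 1` leaves. -/
theorem net_parameter_bounds (hm : 2 ≤ m) (hmd : m + d = n) (hl : l + 2 = m + d ^ 2)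
    (hn : 8 * d ^ 3 + 8 * d ^ 2 < 3 * n + 2 * d) :
    (2 * (4 * d / 3) + 1) * ((d + 1) * d - 1) < l + 1 ∧
      (d + 1) * (n - 1) + (4 * d / 3 + 2).choose 2 * ((d + 1) * d - 1) <
        (4 * d / 3 + 2) * (l + 1) ∧
      (d + 1) * (n - 1) + (d + 2) * (4 * d / 3) ^ 2 < (d + 2) * (l + 1) := by
  have hp : 3 * (4 * d / 3) ≤ 4 * d := by omega
  refine ⟨?_, ?_, mul_sub_one_add_mul_sq_lt hmd hl hn hp⟩
  all_goals obtain rfl | hd := Nat.eq_zero_or_pos d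
  · simp
  · have hq : (d + 1) * d - 1 + 1 = (d + 1) * d := Nat.sub_add_cancel (Nat.mul_pos d.succ_pos hd)
    exact two_mul_add_one_mul_lt hmd hl hq hn hp
  · rw [zero_add, one_mul, mul_zero, Nat.zero_sub, mul_zero]
    omega
  · have hq : (d + 1) * d - 1 + 1 = (d + 1) * d := Nat.sub_add_cancel (Nat.mul_pos d.succ_pos hd)
    exact mul_sub_one_add_choose_two_mul_lt hmd hl hq hn hp (by omega)

end NetParameters

section Nets

open Finset

variable {ι V S : Type*} {A : ι → V → S}

/-- The rows of the array `A` with columns `V` and entries in `S` are pairwise orthogonal: any two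
of them together contain every pair of entries in exactly one column. -/
def PairwiseOrthogonal (A : ι → V → S) : Prop :=
  Pairwise fun i j => Function.Bijective fun c => (A i c, A j c)

theorem PairwiseOrthogonal.eq_of_eq (hA : PairwiseOrthogonal A) {i j : ι} (hij : i ≠ j) {c c' : V}
    (hi : A i c = A i c') (hj : A j c = A j c') : c = c' :=
  (hA hij).1 (Prod.ext hi hj)

theorem PairwiseOrthogonal.exists_eq_and_eq (hA : PairwiseOrthogonal A) {i j : ι} (hij : i ≠ j)
    (a b : S) : ∃ c, A i c = a ∧ A j c = b := by
  obtain ⟨c, hc⟩ := (hA hij).2 (a, b)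
  exact ⟨c, Prod.mk.inj hc⟩

/-- The columns of an array, two of them being adjacent when they disagree in every row. For an
orthogonal array this is the complement of the collinearity graph of the corresponding net. -/
def disagreementGraph (A : ι → V → S) : SimpleGraph V where
  Adj c c' := c ≠ c' ∧ ∀ i, A i c ≠ A i c'
  symm := ⟨fun _ _ h => ⟨h.1.symm, fun i => (h.2 i).symm⟩⟩
  loopless := ⟨fun _ h => h.1 rfl⟩

theorem disagreementGraph_adj_iff [Nonempty ι] {c c' : V} :
    (disagreementGraph A).Adj c c' ↔ ∀ i, A i c ≠ A i c' :=
  and_iff_right_of_imp fun h hc => by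
    obtain ⟨i⟩ := ‹Nonempty ι›
    exact h i (congrArg (A i) hc)

theorem injOn_of_isClique_disagreementGraph {C : Set V} (hC : (disagreementGraph A).IsClique C)
    (i : ι) : Set.InjOn (A i) C := by
  intro c hc c' hc' h
  by_contra hne
  exact (hC hc hc' hne).2 i h

variable [Fintype S]

theorem card_le_of_isClique_disagreementGraph [Nonempty ι] {C : Finset V}
    (hC : (disagreementGraph A).IsClique C) : #C ≤ Fintype.card S := by
  obtain ⟨i⟩ := ‹Nonempty ι›
  exact card_le_card_of_injOn (A i) (fun _ _ => mem_univ _)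
    (injOn_of_isClique_disagreementGraph hC i)

theorem exists_row_of_isClique {P : Finset (Finset V)} (hP : #P = Fintype.card S)
    (hclique : ∀ M ∈ P, (disagreementGraph A).IsClique M) (hcover : ∀ x, ∃ M ∈ P, x ∈ M) :
    ∃ r : V → S, ∀ i, Function.Injective fun c => (A i c, r c) := by
  choose f hf hmem using hcover
  let e : P ≃ S := Fintype.equivOfCardEq (by rw [Fintype.card_coe, hP])
  refine ⟨fun x => e ⟨f x, hf x⟩, fun i c c' h => ?_⟩
  obtain ⟨hi, he⟩ := Prod.mk.inj h
  have hff : f c = f c' := congrArg Subtype.val (e.injective he)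
  exact injOn_of_isClique_disagreementGraph (hclique _ (hf c)) i (hmem c) (hff ▸ hmem c') hi

section

variable [Fintype V]

theorem PairwiseOrthogonal.card_columns [Nontrivial ι] (hA : PairwiseOrthogonal A) :
    Fintype.card V = Fintype.card S ^ 2 := by
  obtain ⟨i, j, hij⟩ := exists_pair_ne ι
  rw [Fintype.card_of_bijective (hA hij), Fintype.card_prod, pow_two]

theorem PairwiseOrthogonal.card_row_fiber [Nontrivial ι] [DecidableEq S] (hA : PairwiseOrthogonal A)
    (i : ι) (a : S) : #{c | A i c = a} = Fintype.card S := by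
  obtain ⟨j, hj⟩ := exists_ne i
  refine card_bij (fun c _ => A j c) (fun _ _ => mem_univ _) (fun c hc c' hc' h => ?_) fun b _ => ?_
  · rw [mem_filter_univ] at hc hc'
    exact hA.eq_of_eq hj.symm (hc.trans hc'.symm) h
  · obtain ⟨c, hi, hjc⟩ := hA.exists_eq_and_eq hj.symm a b
    exact ⟨c, mem_filter_univ _ |>.2 hi, hjc⟩

variable [Fintype ι] [DecidableRel (disagreementGraph A).Adj] {d : ℕ}

/-- A column with entry `a` in row `i` that agrees with the column `x` somewhere does so in exactly
one of the other rows, and each of the other rows gives exactly one such column. -/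
theorem PairwiseOrthogonal.card_neighbor_row_fiber_add [Nontrivial ι] [DecidableEq S]
    (hA : PairwiseOrthogonal A) {x : V} {i : ι} {a : S} (ha : A i x ≠ a) :
    #{c ∈ (disagreementGraph A).neighborFinset x | A i c = a} + Fintype.card ι =
      Fintype.card S + 1 := by
  classical
  have : Nonempty V := ⟨x⟩
  have hexists : ∀ j, j ≠ i → ∃ c, A i c = a ∧ A j c = A j x := fun j hj =>
    hA.exists_eq_and_eq hj.symm a (A j x)
  choose! meet hmeet_i hmeet_j using hexists
  have hagree : ({c | A i c = a} : Finset V).filter (fun c => ¬ (disagreementGraph A).Adj x c) =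
      (univ.erase i).image meet := by
    ext c
    simp only [disagreementGraph_adj_iff, not_forall, not_not, mem_filter, mem_univ, true_and,
      mem_image, mem_erase, and_true]
    constructor
    · rintro ⟨hc, j, hj⟩
      have hji : j ≠ i := fun h => ha (h ▸ hj.trans (h ▸ hc))
      exact ⟨j, hji, hA.eq_of_eq hji ((hmeet_j j hji).trans hj) ((hmeet_i j hji).trans hc.symm)⟩
    · rintro ⟨j, hji, rfl⟩
      exact ⟨hmeet_i j hji, j, (hmeet_j j hji).symm⟩
  have hinj : Set.InjOn meet (univ.erase i : Finset ι) := by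
    intro j hj j' hj' h
    rw [mem_coe, mem_erase] at hj hj'
    by_contra hne
    have hx : meet j = x := hA.eq_of_eq hne (hmeet_j j hj.1) (h ▸ hmeet_j j' hj'.1)
    exact ha (hx ▸ hmeet_i j hj.1)
  have hsplit := card_filter_add_card_filter_not (s := {c | A i c = a})
    ((disagreementGraph A).Adj x)
  rw [hagree, card_image_of_injOn hinj, hA.card_row_fiber, filter_comm,
    ← SimpleGraph.neighborFinset_eq_filter] at hsplit
  have := card_erase_add_one (mem_univ i)
  rw [card_univ] at this
  omega

theorem PairwiseOrthogonal.degree_disagreementGraph [Nontrivial ι] (hA : PairwiseOrthogonal A)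
    (hd : Fintype.card ι + d = Fintype.card S) (x : V) :
    (disagreementGraph A).degree x = (d + 1) * (Fintype.card S - 1) := by
  classical
  obtain ⟨i⟩ : Nonempty ι := inferInstance
  have hfiber : ∀ a ∈ univ.erase (A i x),
      #{c ∈ (disagreementGraph A).neighborFinset x | A i c = a} = d + 1 := fun a ha => by
    have := hA.card_neighbor_row_fiber_add (ne_of_mem_erase ha).symm
    omega
  rw [← SimpleGraph.card_neighborFinset_eq_degree,
    card_eq_sum_card_fiberwise (f := A i) (t := univ.erase (A i x)), sum_congr rfl hfiber,
    sum_const, card_erase_of_mem (mem_univ _), card_univ, smul_eq_mul, mul_comm]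
  intro c hc
  rw [mem_coe, SimpleGraph.mem_neighborFinset] at hc
  simpa using (hc.2 i).symm

variable [DecidableEq V]

theorem PairwiseOrthogonal.card_common_add_of_adj [Nontrivial ι] (hA : PairwiseOrthogonal A)
    (hd : Fintype.card ι + d = Fintype.card S) {x y : V} (hxy : (disagreementGraph A).Adj x y) :
    #((disagreementGraph A).neighborFinset x ∩ (disagreementGraph A).neighborFinset y) + 2 =
      Fintype.card ι + d ^ 2 := by
  classical
  set F : ι → Finset V := fun i =>
    {c ∈ (disagreementGraph A).neighborFinset x | A i c = A i y}.erase y with hF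
  have hF_card : ∀ i, #(F i) = d := fun i => by
    have := hA.card_neighbor_row_fiber_add (hxy.2 i)
    simp only [hF]
    rw [card_erase_of_mem (by simpa using hxy)]
    omega
  have hF_disj : ((univ : Finset ι) : Set ι).PairwiseDisjoint F := by
    refine fun i _ j _ hij => disjoint_left.2 fun c hci hcj => ?_
    simp only [hF, mem_erase, mem_filter] at hci hcj
    exact hci.1 (hA.eq_of_eq hij hci.2.2 hcj.2.2)
  have hsdiff : (disagreementGraph A).neighborFinset x \ (disagreementGraph A).neighborFinset y =
      insert y (univ.biUnion F) := by
    ext c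
    simp only [hF, mem_sdiff, SimpleGraph.mem_neighborFinset, mem_insert, mem_biUnion, mem_univ,
      true_and, mem_erase, mem_filter, disagreementGraph_adj_iff (c := y), not_forall, not_not]
    constructor
    · rintro ⟨hxc, i, hi⟩
      exact or_iff_not_imp_left.2 fun hcy => ⟨i, hcy, hxc, hi.symm⟩
    · rintro (rfl | ⟨i, -, hxc, hi⟩)
      · exact ⟨hxy, Classical.arbitrary ι, rfl⟩
      · exact ⟨hxc, i, hi.symm⟩
  have hsplit := card_sdiff_add_card_inter ((disagreementGraph A).neighborFinset x)
    ((disagreementGraph A).neighborFinset y)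
  rw [hsdiff, card_insert_of_notMem (by simp [hF]), card_biUnion hF_disj,
    sum_congr rfl fun i _ => hF_card i, sum_const, card_univ, smul_eq_mul,
    SimpleGraph.card_neighborFinset_eq_degree, hA.degree_disagreementGraph hd, ← hd] at hsplit
  obtain ⟨m, hm⟩ := Nat.exists_eq_add_of_le' (Fintype.card_pos (α := ι))
  rw [hm, show m + 1 + d - 1 = m + d by omega] at hsplit
  rw [hm]
  linarith

theorem PairwiseOrthogonal.nonadjCommonNeighborsLE_disagreementGraph [Nontrivial ι]
    (hA : PairwiseOrthogonal A) (hd : Fintype.card ι + d = Fintype.card S) :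
    NonadjCommonNeighborsLE (disagreementGraph A) ((d + 1) * d) := by
  classical
  intro x y hne hxy
  obtain ⟨k, hk⟩ : ∃ k, A k x = A k y := by simpa [disagreementGraph_adj_iff] using hxy
  set F : ι → Finset V := fun i => {c ∈ (disagreementGraph A).neighborFinset x | A i c = A i y}
    with hF
  have hF_card : ∀ i ∈ univ.erase k, #(F i) = d + 1 := fun i hi => by
    have := hA.card_neighbor_row_fiber_add fun h => hne (hA.eq_of_eq (ne_of_mem_erase hi) h hk)
    simp only [hF]
    omega
  have hF_disj : ((univ.erase k : Finset ι) : Set ι).PairwiseDisjoint F := by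
    refine fun i _ j _ hij => disjoint_left.2 fun c hci hcj => ?_
    simp only [hF, mem_filter, SimpleGraph.mem_neighborFinset] at hci hcj
    exact hxy (hA.eq_of_eq hij hci.2 hcj.2 ▸ hci.1)
  have hsub : (univ.erase k).biUnion F ⊆
      (disagreementGraph A).neighborFinset x \ (disagreementGraph A).neighborFinset y := by
    refine biUnion_subset.2 fun i _ c hc => ?_
    obtain ⟨hxc, hi⟩ := mem_filter.1 hc
    exact mem_sdiff.2 ⟨hxc, fun h => ((SimpleGraph.mem_neighborFinset _ _ _).1 h).2 i hi.symm⟩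
  have hle := card_le_card hsub
  have hsplit := card_sdiff_add_card_inter ((disagreementGraph A).neighborFinset x)
    ((disagreementGraph A).neighborFinset y)
  rw [card_biUnion hF_disj, sum_congr rfl hF_card, sum_const, smul_eq_mul] at hle
  rw [SimpleGraph.card_neighborFinset_eq_degree, hA.degree_disagreementGraph hd, ← hd,
    ← card_univ, ← card_erase_add_one (mem_univ k), add_right_comm, Nat.add_sub_cancel] at hsplit
  linarith

/-- A column outside a clique with `card S` vertices agrees in each row with exactly one vertex of
the clique, and these vertices are distinct. -/
theorem PairwiseOrthogonal.card_inter_neighborFinset_add (hA : PairwiseOrthogonal A)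
    {C : Finset V} (hC : (disagreementGraph A).IsClique C) (hcard : #C = Fintype.card S) {x : V}
    (hx : x ∉ C) : #(C ∩ (disagreementGraph A).neighborFinset x) + Fintype.card ι = #C := by
  classical
  have hinj := injOn_of_isClique_disagreementGraph hC
  have hsurj : ∀ i, ∃ c ∈ C, A i c = A i x := by
    intro i
    have himage : C.image (A i) = univ := by
      rw [← card_eq_iff_eq_univ, card_image_of_injOn (hinj i), hcard]
    simpa using himage.ge (mem_univ (A i x))
  choose meet hmeet_mem hmeet using hsurj
  have hsdiff : C \ (disagreementGraph A).neighborFinset x = univ.image meet := by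
    ext c
    simp only [mem_sdiff, SimpleGraph.mem_neighborFinset, mem_image, mem_univ, true_and]
    constructor
    · rintro ⟨hc, hxc⟩
      by_contra! hcon
      exact hxc ⟨fun h => hx (h ▸ hc), fun i hi =>
        hcon i (hinj i (hmeet_mem i) hc ((hmeet i).trans hi))⟩
    · rintro ⟨i, rfl⟩
      exact ⟨hmeet_mem i, fun h => h.2 i (hmeet i).symm⟩
  have hmeet_inj : Function.Injective meet := by
    intro i j hij
    by_contra hne
    exact hx (hA.eq_of_eq hne (hmeet i) (hij ▸ hmeet j) ▸ hmeet_mem i)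
  have hsplit := card_sdiff_add_card_inter C ((disagreementGraph A).neighborFinset x)
  rw [hsdiff, card_image_of_injective _ hmeet_inj, card_univ] at hsplit
  omega

end

variable [Fintype ι] {d : ℕ}

theorem PairwiseOrthogonal.exists_isEdgeCliquePartition [Nontrivial ι] [Finite V] [DecidableEq V]
    (hA : PairwiseOrthogonal A) (hd : Fintype.card ι + d = Fintype.card S)
    (hbound : 8 * d ^ 3 + 8 * d ^ 2 < 3 * Fintype.card S + 2 * d) :
    ∃ L, IsEdgeCliquePartition (disagreementGraph A) L ∧ (∀ M ∈ L, #M = Fintype.card S) ∧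
      ∀ x, #{M ∈ L | x ∈ M} = d + 1 := by
  classical
  have := Fintype.ofFinite V
  have hι : 2 ≤ Fintype.card ι := Fintype.one_lt_card
  obtain ⟨l, hl⟩ : ∃ l, l + 2 = Fintype.card ι + d ^ 2 := ⟨Fintype.card ι + d ^ 2 - 2, by omega⟩
  have hcommon : ∀ x y, (disagreementGraph A).Adj x y → #((disagreementGraph A).neighborFinset x ∩
      (disagreementGraph A).neighborFinset y) = l := fun x y h =>
    Nat.add_right_cancel ((hA.card_common_add_of_adj hd h).trans hl.symm)
  have hμ : NonadjCommonNeighborsLE (disagreementGraph A) ((d + 1) * d - 1 + 1) :=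
    fun x y hne hxy => (hA.nonadjCommonNeighborsLE_disagreementGraph hd hne hxy).trans (by omega)
  obtain ⟨hlq, hclaw, hlines⟩ := net_parameter_bounds hι hd hl hbound
  exact exists_isEdgeCliquePartition_card_eq (by omega) (hA.degree_disagreementGraph hd) hcommon hμ
    (fun M hM => card_le_of_isClique_disagreementGraph hM) hlq hclaw hlines

theorem PairwiseOrthogonal.exists_row [Nontrivial ι] [Finite V]
    (hA : PairwiseOrthogonal A) (hd : Fintype.card ι + d = Fintype.card S)
    (hbound : 8 * d ^ 3 + 8 * d ^ 2 < 3 * Fintype.card S + 2 * d) :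
    ∃ r : V → S, ∀ i, Function.Injective fun c => (A i c, r c) := by
  classical
  have := Fintype.ofFinite V
  have hS : 0 < Fintype.card S := by have := Fintype.card_pos (α := ι); omega
  obtain ⟨L, hL, hcard, hthrough⟩ := hA.exists_isEdgeCliquePartition hd hbound
  obtain ⟨x⟩ : Nonempty V := Fintype.card_pos_iff.1 (by rw [hA.card_columns]; positivity)
  obtain ⟨C, hC⟩ : ({M ∈ L | x ∈ M} : Finset (Finset V)).Nonempty :=
    card_pos.1 (by rw [hthrough]; omega)
  replace hC := (mem_filter.1 hC).1
  have hone : ∀ y, #{M ∈ parallelClass L C | y ∈ M} = 1 :=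
    hL.card_parallelClass_filter_mem hC fun y hy => by
      have := hA.card_inter_neighborFinset_add (hL.isClique C hC) (hcard C hC) hy
      rw [hcard C hC] at this
      rw [hthrough]
      omega
  have hsub : ∀ M ∈ parallelClass L C, M ∈ L := fun M hM => (mem_filter.1 hM).1
  have hclass : #(parallelClass L C) * Fintype.card S = Fintype.card V * 1 := by
    rw [← sum_card hone, sum_const_nat fun M hM => hcard M (hsub M hM)]
  rw [hA.card_columns, mul_one, pow_two] at hclass
  refine exists_row_of_isClique (Nat.eq_of_mul_eq_mul_right hS hclass)
    (fun M hM => hL.isClique M (hsub M hM)) fun y => ?_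
  obtain ⟨M, hM⟩ := card_pos.1 ((hone y).symm ▸ Nat.one_pos)
  exact ⟨M, mem_filter.1 hM⟩

end Nets

section OrthogonalArrays

variable {S V : Type*} {m n : ℕ}

/-- The array `A` with the additional last row `r`. -/
def appendRow (A : Matrix (Fin m) V S) (r : V → S) : Matrix (Fin (m + 1)) V S :=
  Fin.snoc (α := fun _ => V → S) A r

theorem appendRow_castSucc (A : Matrix (Fin m) V S) (r : V → S) (i : Fin m) (c : V) :
    appendRow A r i.castSucc c = A i c :=
  congrFun (Fin.snoc_castSucc (α := fun _ => V → S) r A i) c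

theorem appendRow_last (A : Matrix (Fin m) V S) (r : V → S) (c : V) :
    appendRow A r (Fin.last m) c = r c :=
  congrFun (Fin.snoc_last (α := fun _ => V → S) r A) c

variable [Fintype S] {A : Matrix (Fin m) (Fin (n ^ 2)) S}

theorem IsOrthogonalArray.pairwiseOrthogonal (hA : IsOrthogonalArray m n A) :
    PairwiseOrthogonal A := fun i j hij => by
  refine (Fintype.bijective_iff_injective_and_card _).2 ⟨hA.2 i j hij, ?_⟩
  rw [Fintype.card_prod, hA.1, Fintype.card_fin, pow_two]

theorem IsOrthogonalArray.le_add_one (hA : IsOrthogonalArray m n A) (hn : 2 ≤ n) : m ≤ n + 1 := by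
  classical
  by_contra! hlt
  have : Nontrivial (Fin m) := Fin.nontrivial_iff_two_le.2 (by omega)
  have : Nontrivial S := Fintype.one_lt_card_iff_nontrivial.1 (hA.1.symm ▸ hn)
  let x : Fin (n ^ 2) := ⟨0, by positivity⟩
  let i : Fin m := ⟨0, by omega⟩
  obtain ⟨a, ha⟩ := exists_ne (A i x)
  have := hA.pairwiseOrthogonal.card_neighbor_row_fiber_add ha.symm
  rw [Fintype.card_fin, hA.1] at this
  omega

theorem IsOrthogonalArray.exists_row {d : ℕ} (hA : IsOrthogonalArray m n A) (hm : 0 < m)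
    (hmd : m + d = n) (hbound : 8 * d ^ 3 + 8 * d ^ 2 < 3 * n + 2 * d) :
    ∃ r : Fin (n ^ 2) → S, ∀ i, Function.Injective fun c => (A i c, r c) := by
  obtain rfl | hn : n = 1 ∨ 2 ≤ n := by omega
  · exact ⟨A ⟨0, hm⟩, fun i => Function.injective_of_subsingleton (α := Fin 1) _⟩
  · have hm2 : 2 ≤ m := by
      by_contra! hm2
      obtain rfl : m = 1 := by omega
      have hd : 1 ≤ d := by omega
      nlinarith [Nat.pow_le_pow_left hd 2, Nat.pow_le_pow_left hd 3]
    have : Nontrivial (Fin m) := Fin.nontrivial_iff_two_le.2 hm2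
    exact hA.pairwiseOrthogonal.exists_row (by rw [Fintype.card_fin, hmd, hA.1])
      (hA.1.symm ▸ hbound)

theorem IsOrthogonalArray.appendRow (hA : IsOrthogonalArray m n A) {r : Fin (n ^ 2) → S}
    (hr : ∀ i, Function.Injective fun c => (A i c, r c)) :
    IsOrthogonalArray (m + 1) n (appendRow A r) := by
  refine ⟨hA.1, fun i j hij => ?_⟩
  induction i using Fin.lastCases with
  | last =>
    induction j using Fin.lastCases with
    | last => exact absurd rfl hij
    | cast j =>
      simp only [appendRow_last, appendRow_castSucc]
      exact Prod.swap_injective.comp (hr j)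
  | cast i =>
    induction j using Fin.lastCases with
    | last => simpa only [appendRow_last, appendRow_castSucc] using hr i
    | cast j =>
      simpa only [appendRow_castSucc] using hA.2 i j fun h => hij (congrArg Fin.castSucc h)

theorem ExtendsToFull.of_appendRow {r : Fin (n ^ 2) → S}
    (h : ExtendsToFull (m + 1) n (appendRow A r)) : ExtendsToFull m n A := by
  obtain ⟨hm, B, hB, hBA⟩ := h
  refine ⟨by omega, B, hB, fun i c => ?_⟩
  rw [← appendRow_castSucc A r i c]
  exact hBA i.castSucc c

theorem IsOrthogonalArray.extendsToFull {δ : ℕ} (hA : IsOrthogonalArray m n A) (hm : 0 < m)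
    (hδ : m + δ = n + 1) (hbound : 8 * δ ^ 3 + 6 * δ + 2 < 3 * n + 16 * δ ^ 2) :
    ExtendsToFull m n A := by
  induction δ generalizing m with
  | zero =>
    obtain rfl : m = n + 1 := hδ
    exact ⟨le_rfl, A, hA, fun _ _ => rfl⟩
  | succ d ih =>
    obtain ⟨r, hr⟩ := hA.exists_row hm (show m + d = n by omega) (by linarith)
    refine (ih (hA.appendRow hr) (by omega) (by omega) ?_).of_appendRow
    have hn : 1 ≤ n := by omega
    nlinarith

end OrthogonalArrays

theorem corollaryA1 {S : Type*} [Fintype S] (m n : ℕ) (hm : 0 < m) (hn : 0 < n)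
    (hone : n = 1 → m ≤ 2)
    (A : Matrix (Fin m) (Fin (n ^ 2)) S) (hA : IsOrthogonalArray m n A)
    (δ : ℤ) (hδ : δ = (n : ℤ) - (m : ℤ) + 1)
    (hbound : (n : ℝ) > 8 / 3 * (δ : ℝ) ^ 3 - 16 / 3 * (δ : ℝ) ^ 2 + 2 * (δ : ℝ) + 2 / 3) :
    ExtendsToFull m n A := by
  have hmn : m ≤ n + 1 := by
    obtain rfl | hn2 : n = 1 ∨ 2 ≤ n := by omega
    · exact hone rfl
    · exact hA.le_add_one hn2
  lift δ to ℕ using by omega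
  refine hA.extendsToFull (δ := δ) hm (by omega) ?_
  have : (8 * δ ^ 3 + 6 * δ + 2 : ℝ) < 3 * n + 16 * δ ^ 2 := by
    push_cast at hbound
    linarith
  exact_mod_cast this
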